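/- Let $\mathbb K$ be a field of characteristic $0$, and let $\Lambda$ be the algebra of symmetric functions over $\mathbb K$: power series of bounded degree in $x_1,x_2,\dots$ that are invariant under all permutations of the variables. It carries the coproduct $\Delta$ that is an algebra homomorphism with $\Delta p_n=p_n\otimes 1+1\otimes p_n$ for the power sums $p_n=\sum_i x_i^n$, $n\ge 1$. For a partition $\lambda=(\lambda_1,\dots,\lambda_\ell)$ let $m_\lambda$ be the sum of all distinct monomials whose nonzero exponents are the parts of $\lambda$, and let $\widetilde m_\lambda=\big(\prod_{i\ge1} r_i(\lambda)!\big)m_\lambda$, where $r_i(\lambda)$ is the number of parts of $\lambda$ equal to $i$. Let $\widetilde\Lambda$ be the vector space $\Lambda$ with the same coproduct $\Delta$ and with the bilinear product $\odot$ given by $\widetilde m_\lambda\odot\widetilde m_\mu=\widetilde m_{\lambda\sqcup\mu}$, where $\lambda\sqcup\mu$ consists of all parts of $\lambda$ together with all parts of $\mu$. A character of $\widetilde\Lambda$ is a unital $\mathbb K$-algebra homomorphism $\widetilde\Lambda\to\mathbb K$. The convolution of two characters is $(\zeta*\xi)(f)=\sum\zeta(f_1)\,\xi(f_2)$, where $\Delta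 f=\sum f_1\otimes f_2$. A weighted graph $G$ is a finite simple graph with a weight function $w:V(G)\to\{1,2,\dots\}$. Its chromatic symmetric function is $X_G=\sum_\kappa\prod_{v\in V(G)}x_{\kappa(v)}^{w(v)}\in\Lambda$, where $\kappa$ runs over the proper colorings of $G$ by positive integers. Let $\mathrm{St}_\lambda(G)$ be the set of partitions of $V(G)$ into nonempty stable sets whose weights (sums of vertex weights) are the parts of $\lambda$. 1. The map $\zeta\mapsto(\zeta(\widetilde m_n))_{n\ge1}$ is a bijection from the characters of $\widetilde\Lambda$ to the sequences in $\mathbb K$. Write $\zeta_a$ for the character with $\zeta_a(\widetilde m_n)=a_n$ for all $n\ge 1$. 2. For every weighted graph $G$, $$\zeta_a(X_G)=\sum_\lambda|\mathrm{St}_\lambda(G)|\,a_{\lambda_1}\cdots a_{\lambda_\ell},$$ where the sum is over all partitions $\lambda$ and $\mathrm{St}_\lambda(G)$ is nonempty for only finitely many of them. 3. For all sequences $a,b$ the convolution $\zeta_a*\zeta_b$ is again a character, and its sequence has $n$-th term $a_n+b_n$ for all $n\ge1$. -/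

import Mathlib

open MvPowerSeries TensorProduct

noncomputable section
namespace ChromaticTilde

/-- The variables are `x₁, x₂, …`, indexed by the positive integers. Symmetric functions over `K`:
power series of bounded degree that are invariant under every permutation of the variables. -/
def SymFun (K : Type*) [Field K] : Subalgebra K (MvPowerSeries ℕ+ K) where
  carrier := {f | (∃ N : ℕ, ∀ d : ℕ+ →₀ ℕ, coeff d f ≠ 0 → d.degree ≤ N) ∧
    ∀ σ : Equiv.Perm ℕ+, rename σ f = f}
  mul_mem' := by
    classical
    rintro f g ⟨⟨N, hN⟩, hf⟩ ⟨⟨M, hM⟩, hg⟩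
    refine ⟨⟨N + M, fun d hd => ?_⟩, fun σ => by rw [map_mul, hf, hg]⟩
    rw [coeff_mul] at hd
    obtain ⟨p, hp, h⟩ := Finset.exists_ne_zero_of_sum_ne_zero hd
    rw [Finset.HasAntidiagonal.mem_antidiagonal] at hp
    rw [← hp, map_add]
    exact add_le_add (hN _ (left_ne_zero_of_mul h)) (hM _ (right_ne_zero_of_mul h))
  add_mem' := by
    rintro f g ⟨⟨N, hN⟩, hf⟩ ⟨⟨M, hM⟩, hg⟩
    refine ⟨⟨max N M, fun d hd => ?_⟩, fun σ => by rw [map_add, hf, hg]⟩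
    rw [map_add] at hd
    by_cases h : coeff d f = 0
    · exact le_max_of_le_right (hM _ (by simpa [h] using hd))
    · exact le_max_of_le_left (hN _ h)
  algebraMap_mem' := by
    classical
    intro r
    refine ⟨⟨0, fun d hd => ?_⟩, fun σ => AlgHom.commutes _ _⟩
    rw [MvPowerSeries.algebraMap_apply, Algebra.algebraMap_self, RingHom.id_apply, coeff_C] at hd
    have : d = 0 := by by_contra h; simp [h] at hd
    simp [this]

/-- Partitions are finite multisets of positive integers; `λ ⊔ μ` is the sum of multisets. The
partition formed by the nonzero exponents of the monomial `x ^ d`. -/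
def shape {ι : Type*} (d : ι →₀ ℕ) : Multiset ℕ+ := d.support.val.map fun i => (d i).toPNat'

theorem coe_toPNat' {n : ℕ} (h : n ≠ 0) : ((n.toPNat' : ℕ+) : ℕ) = n := by
  obtain ⟨m, rfl⟩ := Nat.exists_eq_succ_of_ne_zero h
  rfl

theorem shape_sum {ι : Type*} (d : ι →₀ ℕ) : ((shape d).map (fun n : ℕ+ => (n : ℕ))).sum = d.degree := by
  rw [shape, Multiset.map_map, Finsupp.degree_apply, Finset.sum]
  congr 1
  refine Multiset.map_congr rfl fun i hi => ?_
  exact coe_toPNat' (by simpa using hi)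

theorem shape_embDomain {ι κ : Type*} (e : ι ↪ κ) (d : ι →₀ ℕ) :
    shape (d.embDomain e) = shape d := by
  rw [shape, shape, Finsupp.support_embDomain, Finset.map_val, Multiset.map_map]
  simp

theorem shape_add {ι : Type*} {d e : ι →₀ ℕ} (h : Disjoint d.support e.support) :
    shape (d + e) = shape d + shape e := by
  classical
  rw [shape, Finsupp.support_add_eq h, ← Finset.disjUnion_eq_union _ _ h, Finset.disjUnion_val,
    Multiset.map_add]
  congr 1
  · refine Multiset.map_congr rfl fun i hi => ?_
    have := Finset.disjoint_left.1 h hi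
    rw [Finsupp.add_apply, Finsupp.notMem_support_iff.1 this, add_zero]
  · refine Multiset.map_congr rfl fun i hi => ?_
    have := Finset.disjoint_right.1 h hi
    rw [Finsupp.add_apply, Finsupp.notMem_support_iff.1 this, zero_add]

theorem shape_single {ι : Type*} (i : ι) (n : ℕ+) : shape (Finsupp.single i (n : ℕ)) = {n} := by
  have : ((n : ℕ).toPNat') = n := by simp
  rw [shape, Finsupp.support_single _ n.ne_zero]
  simp

theorem shape_surjective (p : Multiset ℕ+) : ∃ d : ℕ+ →₀ ℕ, shape d = p := by
  induction p using Multiset.induction with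
  | empty => exact ⟨0, by simp [shape]⟩
  | cons n p ih =>
    obtain ⟨d, rfl⟩ := ih
    obtain ⟨i, hi⟩ := Infinite.exists_notMem_finset d.support
    refine ⟨Finsupp.single i (n : ℕ) + d, ?_⟩
    rw [shape_add, shape_single, Multiset.singleton_add]
    rw [Finsupp.support_single _ n.ne_zero]
    simpa using hi

theorem exists_perm_of_shape_eq {d e : ℕ+ →₀ ℕ} (h : shape d = shape e) :
    ∃ σ : Equiv.Perm ℕ+, e.embDomain σ.toEmbedding = d := by
  classical
  have card (d : ℕ+ →₀ ℕ) (n : ℕ+) :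
      (shape d).count n = Nat.card {i // d i = (n : ℕ)} := by
    rw [shape, Multiset.count_map, ← Finset.filter_val, Finset.card_val]
    refine (Nat.subtype_card _ fun i => ?_).symm
    simp only [Finset.mem_filter, Finsupp.mem_support_iff]
    constructor
    · rintro ⟨h0, h⟩; rw [h, coe_toPNat' h0]
    · intro h; rw [h]; exact ⟨n.ne_zero, by simp⟩
  have fin (d : ℕ+ →₀ ℕ) (n : ℕ) (hn : n ≠ 0) : Finite {i // d i = n} :=
    (d.support.finite_toSet.subset fun i (hi : d i = n) => by simp [hi, hn]).to_subtype
  have inf (d : ℕ+ →₀ ℕ) : Infinite {i // d i = 0} := by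
    have : {i | d i = 0} = ((d.support : Set ℕ+))ᶜ := by ext; simp
    have h2 : ({i | d i = 0}).Infinite := this ▸ d.support.finite_toSet.infinite_compl
    exact h2.to_subtype
  have key (n : ℕ) : Nonempty ({i // e i = n} ≃ {i // d i = n}) := by
    rcases eq_or_ne n 0 with rfl | hn
    · have := inf d; have := inf e
      exact nonempty_equiv_of_countable
    · have := fin d n hn; have := fin e n hn
      refine Finite.card_eq.1 ?_
      rw [← coe_toPNat' hn, ← card, ← card, h]
  let σ : Equiv.Perm ℕ+ := (Equiv.sigmaFiberEquiv e).symm.trans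
    ((Equiv.sigmaCongrRight fun n => (key n).some).trans (Equiv.sigmaFiberEquiv d))
  have hσ (i : ℕ+) : d (σ i) = e i := ((key (e i)).some ⟨i, rfl⟩).2
  refine ⟨σ, ?_⟩
  ext j
  obtain ⟨i, rfl⟩ := σ.surjective j
  rw [hσ]
  exact Finsupp.embDomain_apply_self σ.toEmbedding e i

variable (K : Type*) [Field K]

theorem coeff_rename_perm {K : Type*} [Field K] {ι κ : Type*} (σ : ι ≃ κ) (f : MvPowerSeries ι K)
    (d : ι →₀ ℕ) : coeff (d.embDomain σ.toEmbedding) (rename σ f) = coeff d f :=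
  coeff_embDomain_rename σ.toEmbedding f d

theorem exists_embDomain {ι κ : Type*} (σ : ι ≃ κ) (d : κ →₀ ℕ) :
    ∃ e : ι →₀ ℕ, e.embDomain σ.toEmbedding = d :=
  ⟨d.embDomain σ.symm.toEmbedding, by
    ext j
    obtain ⟨i, rfl⟩ := σ.surjective j
    have := Finsupp.embDomain_apply_self σ.toEmbedding (d.embDomain σ.symm.toEmbedding) i
    refine this.trans ?_
    have := Finsupp.embDomain_apply_self σ.symm.toEmbedding d (σ i)
    simpa using this⟩

theorem rename_eq_self_of_coeff {K : Type*} [Field K] {f : MvPowerSeries ℕ+ K}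
    (σ : Equiv.Perm ℕ+)
    (h : ∀ d, coeff (d.embDomain σ.toEmbedding) f = coeff d f) : rename σ f = f := by
  ext d
  obtain ⟨e, rfl⟩ := exists_embDomain σ d
  rw [coeff_rename_perm, h]

theorem coeff_eq_of_shape_eq {K : Type*} [Field K] (f : SymFun K) {d e : ℕ+ →₀ ℕ}
    (h : shape d = shape e) : coeff d (f : MvPowerSeries ℕ+ K) = coeff e f := by
  obtain ⟨σ, rfl⟩ := exists_perm_of_shape_eq h
  conv_lhs => rw [← f.2.2 σ]
  exact coeff_rename_perm σ _ e

/-- The monomial symmetric function `m_λ`: the sum of all distinct monomials whose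
nonzero exponents are the parts of `λ`. In particular `m_(n)` is the power sum
`p_n = x₁ ^ n + x₂ ^ n + ⋯`. -/
def monoSym (p : Multiset ℕ+) : SymFun K :=
  ⟨fun d => if shape d = p then 1 else 0,
    ⟨⟨(p.map (fun n : ℕ+ => (n : ℕ))).sum, fun d hd => by
      have h : shape d = p := by
        by_contra h
        exact hd (if_neg h)
      rw [← shape_sum, h]⟩,
    fun σ => rename_eq_self_of_coeff σ fun d => by
      change (if _ then _ else _) = if _ then _ else _
      rw [shape_embDomain]⟩⟩

theorem coeff_monoSym (p : Multiset ℕ+) (d : ℕ+ →₀ ℕ) :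
    coeff d (monoSym K p : MvPowerSeries ℕ+ K) = if shape d = p then 1 else 0 := rfl

theorem finite_partitions (N : ℕ) :
    {p : Multiset ℕ+ | (p.map (fun n : ℕ+ => (n : ℕ))).sum ≤ N}.Finite := by
  have h : (Set.Iic (N • (Finset.Icc 1 (N.toPNat')).val : Multiset ℕ+)).Finite := Set.finite_Iic _
  refine h.subset fun p hp => ?_
  rw [Set.mem_Iic, Multiset.le_iff_count]
  intro n
  by_cases hn : n ∈ p
  · have h1 : (n : ℕ) ≤ N :=
      (Multiset.single_le_sum (fun _ _ => Nat.zero_le _) _ (Multiset.mem_map_of_mem _ hn)).trans hp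
    have h2 : p.count n ≤ N := by
      refine (Multiset.count_le_card n p).trans (le_trans ?_ hp)
      have := Multiset.card_nsmul_le_sum (s := p.map (fun n : ℕ+ => (n : ℕ))) (a := 1) (by
        intro x hx
        obtain ⟨y, -, rfl⟩ := Multiset.mem_map.1 hx
        exact y.pos)
      simpa using this
    have h3 : n ∈ Finset.Icc 1 (N.toPNat') := by
      rw [Finset.mem_Icc]
      refine ⟨one_le, ?_⟩
      rw [← PNat.coe_le_coe, coe_toPNat' (by have := n.pos; omega)]
      exact h1
    rw [Multiset.count_nsmul, Multiset.count_eq_one_of_mem (Finset.nodup _) h3]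
    simpa using h2
  · rw [Multiset.count_eq_zero_of_notMem hn]
    exact Nat.zero_le _

theorem coeff_linearCombination (c : Multiset ℕ+ →₀ K) (d : ℕ+ →₀ ℕ) :
    coeff d (Finsupp.linearCombination K (monoSym K) c : MvPowerSeries ℕ+ K) = c (shape d) := by
  induction c using Finsupp.induction_linear with
  | zero => simp
  | add f g hf hg => simp [hf, hg]
  | single p a =>
    rw [Finsupp.linearCombination_single]
    change a * (if _ then _ else _) = _
    by_cases h : shape d = p
    · simp [h]
    · rw [if_neg h, mul_zero, Finsupp.single_apply, if_neg (Ne.symm h)]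

/-- The monomial symmetric functions form a basis. -/
def monoBasis : Module.Basis (Multiset ℕ+) K (SymFun K) :=
  .mk (v := monoSym K)
    (by
      rw [LinearIndependent, injective_iff_map_eq_zero]
      intro c hc
      ext p
      obtain ⟨d, rfl⟩ := shape_surjective p
      rw [← coeff_linearCombination, hc]
      rfl)
    (by
      rintro f -
      rw [← Finsupp.range_linearCombination]
      choose e he using shape_surjective
      obtain ⟨N, hN⟩ := f.2.1
      have fin : (Function.support fun p => coeff (e p) (f : MvPowerSeries ℕ+ K)).Finite :=
        (finite_partitions N).subset fun p hp => by
          have := hN _ hp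
          rwa [← shape_sum, he] at this
      refine ⟨Finsupp.ofSupportFinite _ fin, ?_⟩
      ext d
      rw [coeff_linearCombination]
      exact coeff_eq_of_shape_eq f (he _))

theorem monoBasis_apply (p : Multiset ℕ+) : monoBasis K p = monoSym K p :=
  Module.Basis.mk_apply _ _ p

/-- The augmented monomial symmetric function `m̃_λ = (∏ i, r_i(λ)!) m_λ`, where `r_i(λ)` is
the number of parts of `λ` equal to `i`. -/
def augSym (p : Multiset ℕ+) : SymFun K :=
  ((∏ i ∈ p.toFinset, (p.count i).factorial : ℕ) : K) • monoSym K p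

/-- In characteristic zero the augmented monomial symmetric functions form a basis. -/
def augBasis [CharZero K] : Module.Basis (Multiset ℕ+) K (SymFun K) :=
  (monoBasis K).unitsSMul fun p =>
    Units.mk0 ((∏ i ∈ p.toFinset, (p.count i).factorial : ℕ) : K)
      (Nat.cast_ne_zero.2 (Finset.prod_ne_zero_iff.2 fun _ _ => Nat.factorial_ne_zero _))

theorem augBasis_apply [CharZero K] (p : Multiset ℕ+) : augBasis K p = augSym K p := by
  rw [augBasis, Module.Basis.unitsSMul_apply, monoBasis_apply]
  rfl

/-- The series in two sets of variables `x`, `y` attached to a tensor: `f ⊗ g ↦ f(x) g(y)`. -/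
def expand : SymFun K ⊗[K] SymFun K →ₐ[K] MvPowerSeries (ℕ+ ⊕ ℕ+) K :=
  Algebra.TensorProduct.productMap
    ((rename (Function.Embedding.inl : ℕ+ ↪ ℕ+ ⊕ ℕ+)).comp (SymFun K).val)
    ((rename (Function.Embedding.inr : ℕ+ ↪ ℕ+ ⊕ ℕ+)).comp (SymFun K).val)

theorem disjoint_inl_inr (d e : ℕ+ →₀ ℕ) :
    Disjoint (d.embDomain (Function.Embedding.inl : ℕ+ ↪ ℕ+ ⊕ ℕ+)).support
      (e.embDomain (Function.Embedding.inr : ℕ+ ↪ ℕ+ ⊕ ℕ+)).support := by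
  rw [Finset.disjoint_left]
  intro i h1 h2
  rw [Finsupp.support_embDomain, Finset.mem_map] at h1 h2
  obtain ⟨a, -, rfl⟩ := h1
  obtain ⟨b, -, hb⟩ := h2
  cases hb

theorem inl_add_inr_injective {d e d' e' : ℕ+ →₀ ℕ}
    (h : d.embDomain (Function.Embedding.inl : ℕ+ ↪ ℕ+ ⊕ ℕ+) +
        e.embDomain (Function.Embedding.inr : ℕ+ ↪ ℕ+ ⊕ ℕ+) =
      d'.embDomain (Function.Embedding.inl : ℕ+ ↪ ℕ+ ⊕ ℕ+) +
        e'.embDomain (Function.Embedding.inr : ℕ+ ↪ ℕ+ ⊕ ℕ+)) : d = d' ∧ e = e' := by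
  have l (d e : ℕ+ →₀ ℕ) (i : ℕ+) : (d.embDomain (Function.Embedding.inl : ℕ+ ↪ ℕ+ ⊕ ℕ+) +
        e.embDomain (Function.Embedding.inr : ℕ+ ↪ ℕ+ ⊕ ℕ+)) (Sum.inl i) = d i := by
    rw [Finsupp.add_apply]
    have h1 := Finsupp.embDomain_apply_self (Function.Embedding.inl : ℕ+ ↪ ℕ+ ⊕ ℕ+) d i
    have h2 := Finsupp.embDomain_of_notMem_range (Function.Embedding.inr : ℕ+ ↪ ℕ+ ⊕ ℕ+) e
      (Sum.inl i) (by rintro ⟨a, ha⟩; cases ha)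
    rw [h2]
    exact h1
  have r (d e : ℕ+ →₀ ℕ) (i : ℕ+) : (d.embDomain (Function.Embedding.inl : ℕ+ ↪ ℕ+ ⊕ ℕ+) +
        e.embDomain (Function.Embedding.inr : ℕ+ ↪ ℕ+ ⊕ ℕ+)) (Sum.inr i) = e i := by
    rw [Finsupp.add_apply]
    have h1 := Finsupp.embDomain_apply_self (Function.Embedding.inr : ℕ+ ↪ ℕ+ ⊕ ℕ+) e i
    have h2 := Finsupp.embDomain_of_notMem_range (Function.Embedding.inl : ℕ+ ↪ ℕ+ ⊕ ℕ+) d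
      (Sum.inr i) (by rintro ⟨a, ha⟩; cases ha)
    rw [h2, zero_add]
    exact h1
  constructor
  · ext i; rw [← l d e, h, l]
  · ext i; rw [← r d e, h, r]

theorem exists_inl_add_inr (d : ℕ+ ⊕ ℕ+ →₀ ℕ) : ∃ a b : ℕ+ →₀ ℕ,
    d = a.embDomain Function.Embedding.inl + b.embDomain Function.Embedding.inr := by
  induction d using Finsupp.induction_linear with
  | zero => exact ⟨0, 0, by simp⟩
  | add f g hf hg =>
    obtain ⟨a, b, rfl⟩ := hf
    obtain ⟨a', b', rfl⟩ := hg
    exact ⟨a + a', b + b', by rw [Finsupp.embDomain_add, Finsupp.embDomain_add]; abel⟩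
  | single i n =>
    rcases i with i | i
    · exact ⟨Finsupp.single i n, 0, by rw [Finsupp.embDomain_single]; simp⟩
    · exact ⟨0, Finsupp.single i n, by rw [Finsupp.embDomain_single]; simp⟩

theorem coeff_expand_tmul (f g : SymFun K) (d e : ℕ+ →₀ ℕ) :
    coeff (d.embDomain Function.Embedding.inl + e.embDomain Function.Embedding.inr)
      (expand K (f ⊗ₜ g)) = coeff d (f : MvPowerSeries ℕ+ K) * coeff e (g : MvPowerSeries ℕ+ K) := by
  classical
  rw [expand, Algebra.TensorProduct.productMap_apply_tmul, coeff_mul, Finset.sum_eq_single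
    (d.embDomain Function.Embedding.inl, e.embDomain Function.Embedding.inr)]
  · rw [AlgHom.comp_apply, AlgHom.comp_apply, coeff_embDomain_rename, coeff_embDomain_rename]
    rfl
  · rintro ⟨a, b⟩ hab hne
    rw [Finset.HasAntidiagonal.mem_antidiagonal] at hab
    by_contra h
    have ha : a ∈ Set.range (Finsupp.mapDomain (Function.Embedding.inl : ℕ+ ↪ ℕ+ ⊕ ℕ+)) := by
      by_contra h'
      exact left_ne_zero_of_mul h (coeff_rename_eq_zero _ _ h')
    have hb : b ∈ Set.range (Finsupp.mapDomain (Function.Embedding.inr : ℕ+ ↪ ℕ+ ⊕ ℕ+)) := by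
      by_contra h'
      exact right_ne_zero_of_mul h (coeff_rename_eq_zero _ _ h')
    obtain ⟨a, rfl⟩ := ha
    obtain ⟨b, rfl⟩ := hb
    rw [← Finsupp.embDomain_eq_mapDomain, ← Finsupp.embDomain_eq_mapDomain] at hab hne
    obtain ⟨rfl, rfl⟩ := inl_add_inr_injective hab
    exact hne rfl
  · intro h
    rw [Finset.HasAntidiagonal.mem_antidiagonal] at h
    exact absurd rfl h

theorem coeff_expand (t : SymFun K ⊗[K] SymFun K) (d e : ℕ+ →₀ ℕ) :
    coeff (d.embDomain Function.Embedding.inl + e.embDomain Function.Embedding.inr)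
      (expand K t) = ((monoBasis K).tensorProduct (monoBasis K)).repr t (shape d, shape e) := by
  suffices h : (coeff (d.embDomain Function.Embedding.inl + e.embDomain Function.Embedding.inr)) ∘ₗ
      (expand K).toLinearMap = Finsupp.lapply (shape d, shape e) ∘ₗ
        ((monoBasis K).tensorProduct (monoBasis K)).repr.toLinearMap from LinearMap.congr_fun h t
  refine ((monoBasis K).tensorProduct (monoBasis K)).ext fun ⟨p, q⟩ => ?_
  simp only [LinearMap.comp_apply, AlgHom.toLinearMap_apply, LinearEquiv.coe_coe,
    Module.Basis.repr_self, Finsupp.lapply_apply]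
  rw [Module.Basis.tensorProduct_apply, monoBasis_apply, monoBasis_apply, coeff_expand_tmul,
    coeff_monoSym, coeff_monoSym, Finsupp.single_apply]
  simp only [eq_comm (a := shape d), eq_comm (a := shape e)]
  by_cases h1 : p = shape d <;> by_cases h2 : q = shape e <;> simp [h1, h2]

theorem expand_injective : Function.Injective (expand K) := by
  intro s t h
  refine ((monoBasis K).tensorProduct (monoBasis K)).repr.injective ?_
  ext ⟨p, q⟩
  obtain ⟨d, rfl⟩ := shape_surjective p
  obtain ⟨e, rfl⟩ := shape_surjective q
  rw [← coeff_expand, ← coeff_expand, h]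

/-- The coproduct as a linear map: `Δ m_λ = ∑ m_μ ⊗ m_ν` over all pairs with `μ ⊔ ν = λ`. -/
def comulLin : SymFun K →ₗ[K] SymFun K ⊗[K] SymFun K :=
  (monoBasis K).constr K fun p => ∑ q ∈ p.antidiagonal.toFinset, monoSym K q.1 ⊗ₜ monoSym K q.2

theorem comulLin_monoSym (p : Multiset ℕ+) : comulLin K (monoSym K p) =
    ∑ q ∈ p.antidiagonal.toFinset, monoSym K q.1 ⊗ₜ monoSym K q.2 := by
  rw [comulLin, ← monoBasis_apply, Module.Basis.constr_basis]

/-- The coproduct splits the variables into two countable sets: `Δ f = f(x, y)`. -/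
theorem expand_comulLin (σ : ℕ+ ≃ ℕ+ ⊕ ℕ+) (f : SymFun K) :
    expand K (comulLin K f) = rename σ (f : MvPowerSeries ℕ+ K) := by
  suffices h : (expand K).toLinearMap ∘ₗ comulLin K =
      (rename σ).toLinearMap ∘ₗ (SymFun K).val.toLinearMap from LinearMap.congr_fun h f
  refine (monoBasis K).ext fun p => ?_
  simp only [LinearMap.comp_apply, AlgHom.toLinearMap_apply, monoBasis_apply]
  ext d
  obtain ⟨a, b, rfl⟩ := exists_inl_add_inr d
  have hs : shape (a.embDomain (Function.Embedding.inl : ℕ+ ↪ ℕ+ ⊕ ℕ+) +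
      b.embDomain (Function.Embedding.inr : ℕ+ ↪ ℕ+ ⊕ ℕ+)) = shape a + shape b := by
    rw [shape_add (disjoint_inl_inr a b), shape_embDomain, shape_embDomain]
  have hl : coeff (a.embDomain Function.Embedding.inl + b.embDomain Function.Embedding.inr)
      (expand K (comulLin K (monoSym K p))) = if shape a + shape b = p then 1 else 0 := by
    rw [comulLin_monoSym, map_sum, map_sum]
    simp only [coeff_expand_tmul, coeff_monoSym]
    by_cases h : shape a + shape b = p
    · rw [if_pos h, Finset.sum_eq_single (shape a, shape b)]
      · simp
      · rintro ⟨x, y⟩ - hxy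
        by_cases hx : shape a = x
        · by_cases hy : shape b = y
          · exact absurd (by rw [hx, hy]) hxy
          · simp [hy]
        · simp [hx]
      · intro h'
        exact absurd (by simpa using h) h'
    · rw [if_neg h]
      refine Finset.sum_eq_zero ?_
      rintro ⟨x, y⟩ hxy
      have hxy : x + y = p := by simpa using hxy
      by_cases hx : shape a = x
      · by_cases hy : shape b = y
        · exact absurd (by rw [hx, hy, hxy]) h
        · simp [hy]
      · simp [hx]
  rw [hl, ← hs]
  obtain ⟨c, hc⟩ := exists_embDomain σ
    (a.embDomain Function.Embedding.inl + b.embDomain Function.Embedding.inr)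
  rw [← hc, shape_embDomain]
  exact (coeff_rename_perm σ (monoSym K p : MvPowerSeries ℕ+ K) c).symm

/-- The coproduct of `Λ`: the algebra homomorphism, for the ordinary product of power series, for
which the power sums `p_n = m_(n)` are primitive, see `comulΛ_powerSum`. In characteristic zero
this determines it, because the power sums generate `Λ`. -/
def comulΛ : SymFun K →ₐ[K] SymFun K ⊗[K] SymFun K :=
  AlgHom.ofLinearMap (comulLin K)
    (by
      have σ : ℕ+ ≃ ℕ+ ⊕ ℕ+ := (nonempty_equiv_of_countable).some
      apply expand_injective
      rw [expand_comulLin K σ, map_one]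
      exact map_one _)
    (by
      have σ : ℕ+ ≃ ℕ+ ⊕ ℕ+ := (nonempty_equiv_of_countable).some
      intro f g
      apply expand_injective
      rw [map_mul (expand K), expand_comulLin K σ, expand_comulLin K σ, expand_comulLin K σ]
      exact map_mul _ _ _)

theorem monoSym_zero : monoSym K 0 = 1 := by
  classical
  ext d
  rw [coeff_monoSym]
  change _ = coeff d (1 : MvPowerSeries ℕ+ K)
  rw [coeff_one]
  congr 1
  rw [shape, Multiset.map_eq_zero, Finset.val_eq_zero, Finsupp.support_eq_empty]

theorem comulΛ_powerSum (n : ℕ+) :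
    comulΛ K (monoSym K {n}) = monoSym K {n} ⊗ₜ 1 + 1 ⊗ₜ monoSym K {n} := by
  have h : (({n} : Multiset ℕ+).antidiagonal).toFinset = {({n}, 0), (0, {n})} := by
    rw [← Multiset.cons_zero, Multiset.antidiagonal_cons]
    ext x
    simp [or_comm]
  change comulLin K (monoSym K {n}) = _
  rw [comulLin_monoSym, h, Finset.sum_pair (by simp), monoSym_zero]

/-- Tsujie's ring `Λ̃`: the vector space of symmetric functions, with a different product. -/
def TildeSym : Type _ := SymFun K

instance TildeSym.instAddCommGroup : AddCommGroup (TildeSym K) := inferInstanceAs (AddCommGroup (SymFun K))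

instance TildeSym.instModule : Module K (TildeSym K) := inferInstanceAs (Module K (SymFun K))

/-- The identity map from `Λ` to `Λ̃`, a linear isomorphism. -/
def toTilde : SymFun K ≃ₗ[K] TildeSym K := LinearEquiv.refl K (SymFun K)

section

variable [CharZero K]

/-- The basis `m̃_λ` of `Λ̃`. -/
def tildeBasis : Module.Basis (Multiset ℕ+) K (TildeSym K) := (augBasis K).map (toTilde K)

theorem tildeBasis_apply (p : Multiset ℕ+) : tildeBasis K p = toTilde K (augSym K p) := by
  rw [tildeBasis, Module.Basis.map_apply, augBasis_apply]

/-- The product of `Λ̃`: the bilinear map with `m̃_λ ⊙ m̃_μ = m̃_(λ ⊔ μ)`. -/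
def tildeMul : TildeSym K →ₗ[K] TildeSym K →ₗ[K] TildeSym K :=
  (tildeBasis K).constr K fun p => (tildeBasis K).constr K fun q => toTilde K (augSym K (p + q))

theorem tildeMul_basis (p q : Multiset ℕ+) :
    tildeMul K (tildeBasis K p) (tildeBasis K q) = tildeBasis K (p + q) := by
  rw [tildeMul, Module.Basis.constr_basis, Module.Basis.constr_basis, tildeBasis_apply]

theorem tildeMul_comm (f g : TildeSym K) : tildeMul K f g = tildeMul K g f := by
  suffices h : tildeMul K = (tildeMul K).flip from LinearMap.congr_fun₂ h f g
  refine (tildeBasis K).ext fun p => (tildeBasis K).ext fun q => ?_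
  rw [LinearMap.flip_apply, tildeMul_basis, tildeMul_basis, add_comm]

theorem tildeMul_assoc (f g h : TildeSym K) :
    tildeMul K (tildeMul K f g) h = tildeMul K f (tildeMul K g h) := by
  have key : ∀ p q, (tildeMul K (tildeMul K (tildeBasis K p) (tildeBasis K q))) =
      tildeMul K (tildeBasis K p) ∘ₗ tildeMul K (tildeBasis K q) := fun p q =>
    (tildeBasis K).ext fun r => by
      rw [LinearMap.comp_apply, tildeMul_basis, tildeMul_basis, tildeMul_basis, tildeMul_basis,
        add_assoc]
  have key2 : ∀ p, (tildeMul K) ∘ₗ (tildeMul K (tildeBasis K p)) =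
      (LinearMap.llcomp K _ _ _ (tildeMul K (tildeBasis K p))) ∘ₗ tildeMul K := fun p =>
    (tildeBasis K).ext fun q => key p q
  have key3 : (LinearMap.llcomp K _ _ _ (tildeMul K)) ∘ₗ tildeMul K =
      ((LinearMap.llcomp K _ _ _).flip (tildeMul K)) ∘ₗ
        (LinearMap.llcomp K (TildeSym K) (TildeSym K) (TildeSym K)) ∘ₗ tildeMul K :=
    (tildeBasis K).ext fun p => key2 p
  exact LinearMap.congr_fun (LinearMap.congr_fun₂ key3 f g) h

theorem tildeMul_one (f : TildeSym K) : tildeMul K f (toTilde K (augSym K 0)) = f := by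
  suffices h : (tildeMul K).flip (toTilde K (augSym K 0)) = LinearMap.id from
    LinearMap.congr_fun h f
  refine (tildeBasis K).ext fun p => ?_
  rw [LinearMap.flip_apply, ← tildeBasis_apply, tildeMul_basis, add_zero, LinearMap.id_apply]

instance TildeSym.instCommRing : CommRing (TildeSym K) where
  __ := TildeSym.instAddCommGroup K
  mul f g := tildeMul K f g
  one := toTilde K (augSym K 0)
  left_distrib f g h := map_add (tildeMul K f) g h
  right_distrib f g h := LinearMap.map_add₂ (tildeMul K) f g h
  zero_mul f := LinearMap.map_zero₂ (tildeMul K) f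
  mul_zero f := map_zero (tildeMul K f)
  mul_assoc := tildeMul_assoc K
  mul_comm := tildeMul_comm K
  one_mul f := (tildeMul_comm K _ f).trans (tildeMul_one K f)
  mul_one := tildeMul_one K

instance TildeSym.instAlgebra : Algebra K (TildeSym K) :=
  Algebra.ofModule (fun r f g => LinearMap.map_smul₂ (tildeMul K) r f g)
    (fun r f g => map_smul (tildeMul K f) r g)

theorem toTilde_augSym_mul (p q : Multiset ℕ+) :
    toTilde K (augSym K p) * toTilde K (augSym K q) = toTilde K (augSym K (p + q)) := by
  rw [← tildeBasis_apply, ← tildeBasis_apply, ← tildeBasis_apply]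
  exact tildeMul_basis K p q

end

/-- `Λ̃` has the same coproduct and the same counit as `Λ`; the counit sends every variable to
zero, so it is the constant coefficient. -/
instance TildeSym.instCoalgebraStruct : CoalgebraStruct K (TildeSym K) where
  comul := TensorProduct.map (toTilde K).toLinearMap (toTilde K).toLinearMap ∘ₗ
    (comulΛ K).toLinearMap ∘ₗ (toTilde K).symm.toLinearMap
  counit := coeff 0 ∘ₗ (SymFun K).val.toLinearMap ∘ₗ (toTilde K).symm.toLinearMap

/-- A weighted graph on the vertex set `V`. -/
structure WeightedGraph (V : Type*) where
  /-- the underlying simple graph -/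
  graph : SimpleGraph V
  /-- the positive integer weight of each vertex -/
  weight : V → ℕ+

namespace WeightedGraph

variable {V : Type*} [Fintype V] (G : WeightedGraph V)

theorem prod_X_pow {ι : Type*} (c : V → ι) : ∏ v, (X (c v) : MvPowerSeries ι K) ^ (G.weight v : ℕ) =
    monomial (∑ v, Finsupp.single (c v) (G.weight v : ℕ)) 1 := by
  simp only [X_pow_eq]
  induction (Finset.univ : Finset V) using Finset.cons_induction with
  | empty => simp
  | cons v s hv ih => rw [Finset.prod_cons, Finset.sum_cons, ih, monomial_mul_monomial, one_mul]

/-- Only finitely many proper colorings contribute to a given coefficient. -/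
theorem finite_colorings (d : ℕ+ →₀ ℕ) : (Function.support fun c : G.graph.Coloring ℕ+ =>
    coeff d (∏ v, (X (c v) : MvPowerSeries ℕ+ K) ^ (G.weight v : ℕ))).Finite := by
  classical
  have h : ({f : V → ℕ+ | ∀ v, f v ∈ d.support}).Finite := by
    have := Set.Finite.pi' (fun _ : V => d.support.finite_toSet)
    simpa using this
  refine (h.preimage (f := fun c : G.graph.Coloring ℕ+ => (c : V → ℕ+))
    DFunLike.coe_injective.injOn).subset fun c hc v => ?_
  rw [Function.mem_support, prod_X_pow, coeff_monomial] at hc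
  have hd : d = ∑ v, Finsupp.single (c v) (G.weight v : ℕ) := by
    by_contra h; exact hc (if_neg h)
  rw [Finsupp.mem_support_iff, hd, Finsupp.finsetSum_apply]
  intro h0
  have := (Finset.sum_eq_zero_iff.1 h0) v (Finset.mem_univ v)
  simp at this

/-- The chromatic symmetric function `X_G = ∑ κ, ∏ v, x_(κ v) ^ w(v)`, where `κ` runs over the
proper colorings of `G` by positive integers. The sum of power series is taken coefficientwise,
and every coefficient is a finite sum by `finite_colorings`. -/
def csf : SymFun K :=
  ⟨fun d => ∑ᶠ c : G.graph.Coloring ℕ+,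
      coeff d (∏ v, (X (c v) : MvPowerSeries ℕ+ K) ^ (G.weight v : ℕ)), by
    classical
    refine ⟨⟨∑ v, (G.weight v : ℕ), fun d hd => ?_⟩, fun σ => rename_eq_self_of_coeff σ fun d => ?_⟩
    · obtain ⟨c, hc⟩ : ∃ c : G.graph.Coloring ℕ+,
          coeff d (∏ v, (X (c v) : MvPowerSeries ℕ+ K) ^ (G.weight v : ℕ)) ≠ 0 := by
        by_contra! h
        exact hd ((finsum_congr h).trans finsum_zero)
      rw [prod_X_pow, coeff_monomial] at hc
      have hd : d = ∑ v, Finsupp.single (c v) (G.weight v : ℕ) := by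
        by_contra h; exact hc (if_neg h)
      rw [hd, map_sum]
      simp
    · change (∑ᶠ c : G.graph.Coloring ℕ+, coeff (d.embDomain σ.toEmbedding) _) =
        ∑ᶠ c : G.graph.Coloring ℕ+, coeff d _
      let τ : G.graph.Coloring ℕ+ ≃ G.graph.Coloring ℕ+ :=
        { toFun c := SimpleGraph.Coloring.mk (fun v => σ (c v)) fun h h' =>
            c.valid h (σ.injective h')
          invFun c := SimpleGraph.Coloring.mk (fun v => σ.symm (c v)) fun h h' =>
            c.valid h (σ.symm.injective h')
          left_inv c := DFunLike.ext _ _ fun v => σ.symm_apply_apply (c v)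
          right_inv c := DFunLike.ext _ _ fun v => σ.apply_symm_apply (c v) }
      rw [← finsum_comp_equiv τ]
      refine finsum_congr fun c => ?_
      rw [← coeff_rename_perm σ (∏ v, X (c v) ^ (G.weight v : ℕ)),
        map_prod (rename (R := K) σ)]
      simp only [map_pow, rename_X]
      rfl⟩

/-- `St_λ(G)`: the partitions of the vertex set into (nonempty) stable sets whose weights are the
parts of `λ`. -/
def stablePartitions [DecidableEq V] (p : Multiset ℕ+) :
    Set (Finpartition (Finset.univ : Finset V)) :=
  {P | (∀ s ∈ P.parts, G.graph.IsIndepSet (s : Set V)) ∧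
    P.parts.val.map (fun s => ∑ v ∈ s, (G.weight v : ℕ)) = p.map (fun n : ℕ+ => (n : ℕ))}

end WeightedGraph

end ChromaticTilde

end

/-! The `m̃_λ` form a basis in characteristic zero and multiply by joining multisets, so `Λ̃` is the
polynomial algebra on the `m̃_n`. Its characters are therefore free choices of the values at the
`m̃_n` (`bijective_character_values`), and each sends `m̃_λ` to the product over the parts
(`apply_toTilde_augSym`).

For the chromatic function, a proper coloring is a partition of `V` into stable sets together with
an injective choice of colors for its parts (`bijective_coloringOfParts`). For fixed parts, a
monomial of the right shape arises from as many injections as there are weight preserving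
permutations of the parts, which is `∏ r_i!` (`card_placement_eq`). The factor that turns `m_λ` into
`m̃_λ` is exactly this number, so `X_G` is a sum of one `m̃` for each stable partition
(`csf_eq_sum`), and applying a character gives the formula.

For convolution, the same factorials turn the coproduct of `m̃_λ` into the sum over all ways to
distribute the parts of `λ`, with multiplicity (`count_antidiagonal_mul_autCard`,
`comulLin_augSym`). This is the pattern by which `∏ (a_n + b_n)` expands, so the convolution agrees
with the character of `a + b` on the basis. -/

namespace ChromaticTilde

/-! ### Factorials and the multiplicities of splittings of a multiset -/

section Automorphisms

/-- The factor `∏ i, r_i(λ)!` of the augmented monomial symmetric function. -/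
def autCard (p : Multiset ℕ+) : ℕ := ∏ i ∈ p.toFinset, (p.count i).factorial

theorem autCard_eq_prod (p : Multiset ℕ+) (s : Finset ℕ+) (h : p.toFinset ⊆ s) :
    autCard p = ∏ i ∈ s, (p.count i).factorial := by
  refine Finset.prod_subset h fun i _ hi => ?_
  rw [Multiset.mem_toFinset] at hi
  rw [Multiset.count_eq_zero_of_notMem hi, Nat.factorial_zero]

theorem autCard_cons (a : ℕ+) (p : Multiset ℕ+) :
    autCard (a ::ₘ p) = (p.count a + 1) * autCard p := by
  have ha : a ∈ (a ::ₘ p).toFinset := by simp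
  have hs : p.toFinset ⊆ (a ::ₘ p).toFinset := by
    rw [Multiset.toFinset_cons]
    exact Finset.subset_insert _ _
  rw [autCard_eq_prod p _ hs, autCard, ← Finset.mul_prod_erase _ _ ha,
    ← Finset.mul_prod_erase _ (fun i => (p.count i).factorial) ha, Multiset.count_cons_self,
    Nat.factorial_succ, mul_assoc]
  congr 2
  refine Finset.prod_congr rfl fun i hi => ?_
  rw [Multiset.count_cons_of_ne (Finset.ne_of_mem_erase hi)]

theorem autCard_eq_count_mul_erase {a : ℕ+} {p : Multiset ℕ+} (h : a ∈ p) :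
    autCard p = p.count a * autCard (p.erase a) := by
  obtain ⟨q, rfl⟩ := Multiset.exists_cons_of_mem h
  rw [autCard_cons, Multiset.erase_cons_head, Multiset.count_cons_self]

/-- Adding `a` to one component is injective, so multiplicities carry over. With its mirror image
this handles the two halves of `Multiset.antidiagonal_cons`. -/
theorem count_map_cons_right (s : Multiset (Multiset ℕ+ × Multiset ℕ+)) (a : ℕ+)
    (x y : Multiset ℕ+) :
    (s.map (Prod.map id (a ::ₘ ·))).count (x, y) =
      if a ∈ y then s.count (x, y.erase a) else 0 := by
  split_ifs with h
  · obtain ⟨z, rfl⟩ := Multiset.exists_cons_of_mem h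
    rw [Multiset.erase_cons_head]
    refine Multiset.count_map_eq_count' (Prod.map id (a ::ₘ ·)) s ?_ (x, z)
    exact Function.injective_id.prodMap fun _ _ h => (Multiset.cons_inj_right a).1 h
  · refine Multiset.count_eq_zero_of_notMem fun hm => h ?_
    obtain ⟨⟨u, v⟩, -, huv⟩ := Multiset.mem_map.1 hm
    obtain ⟨-, rfl⟩ := Prod.mk.inj huv
    exact Multiset.mem_cons_self a v

theorem count_map_cons_left (s : Multiset (Multiset ℕ+ × Multiset ℕ+)) (a : ℕ+)
    (x y : Multiset ℕ+) :
    (s.map (Prod.map (a ::ₘ ·) id)).count (x, y) =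
      if a ∈ x then s.count (x.erase a, y) else 0 := by
  split_ifs with h
  · obtain ⟨z, rfl⟩ := Multiset.exists_cons_of_mem h
    rw [Multiset.erase_cons_head]
    refine Multiset.count_map_eq_count' (Prod.map (a ::ₘ ·) id) s ?_ (z, y)
    exact Function.Injective.prodMap (fun _ _ h => (Multiset.cons_inj_right a).1 h)
      Function.injective_id
  · refine Multiset.count_eq_zero_of_notMem fun hm => h ?_
    obtain ⟨⟨u, v⟩, -, huv⟩ := Multiset.mem_map.1 hm
    obtain ⟨rfl, -⟩ := Prod.mk.inj huv
    exact Multiset.mem_cons_self a u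

/-- The multiplicity is a product of binomial coefficients, one for each size of part. The induction
is Pascal's rule: a new copy of `a` goes to `y` or to `x`. -/
theorem count_antidiagonal_mul_autCard {p : Multiset ℕ+} {x y : Multiset ℕ+} (h : x + y = p) :
    p.antidiagonal.count (x, y) * (autCard x * autCard y) = autCard p := by
  induction p using Multiset.induction generalizing x y with
  | empty =>
    obtain ⟨rfl, rfl⟩ := add_eq_zero.1 h
    simp [autCard]
  | cons a p ih =>
    have hc : x.count a + y.count a = p.count a + 1 := by
      rw [← Multiset.count_add, h, Multiset.count_cons_self]
    -- The splittings with the new `a` in `y`; `hl` treats those with it in `x`. By `hc` the two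
    -- factors add up to `p.count a + 1`.
    have hr : (if a ∈ y then p.antidiagonal.count (x, y.erase a) else 0) *
        (autCard x * autCard y) = y.count a * autCard p := by
      split_ifs with ha
      · rw [← ih (x := x) (y := y.erase a) (by
          rw [← Multiset.erase_add_right_pos _ ha, h, Multiset.erase_cons_head]),
          autCard_eq_count_mul_erase ha]
        ring
      · rw [Multiset.count_eq_zero_of_notMem ha, zero_mul, zero_mul]
    have hl : (if a ∈ x then p.antidiagonal.count (x.erase a, y) else 0) *
        (autCard x * autCard y) = x.count a * autCard p := by
      split_ifs with ha
      · rw [← ih (x := x.erase a) (y := y) (by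
          rw [← Multiset.erase_add_left_pos _ ha, h, Multiset.erase_cons_head]),
          autCard_eq_count_mul_erase ha]
        ring
      · rw [Multiset.count_eq_zero_of_notMem ha, zero_mul, zero_mul]
    rw [Multiset.antidiagonal_cons, Multiset.count_add, count_map_cons_right,
      count_map_cons_left, add_mul, hr, hl, autCard_cons, ← hc]
    ring

end Automorphisms

/-! ### Characters of `Λ̃` and their convolution -/

section Characters

variable (K : Type*) [Field K]

theorem augSym_eq_smul (p : Multiset ℕ+) : augSym K p = (autCard p : K) • monoSym K p := rfl

/-- `Δ m̃_λ = ∑ m̃_μ ⊗ m̃_ν`, over the ways to split the parts of `λ`, with multiplicity. -/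
theorem comulLin_augSym (p : Multiset ℕ+) : comulLin K (augSym K p) =
    (p.antidiagonal.map fun q => augSym K q.1 ⊗ₜ[K] augSym K q.2).sum := by
  rw [augSym_eq_smul, map_smul, comulLin_monoSym, Finset.smul_sum, Finset.sum_multiset_map_count]
  refine Finset.sum_congr rfl fun ⟨x, y⟩ hq => ?_
  have h : x + y = p := by simpa using hq
  -- It remains to compare the coefficients of `m_x ⊗ m_y`, which is the identity of factorials.
  rw [augSym_eq_smul, augSym_eq_smul, smul_tmul_smul, ← Nat.cast_smul_eq_nsmul K, smul_smul,
    ← count_antidiagonal_mul_autCard h]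
  push_cast
  rfl

variable [CharZero K]

theorem toTilde_augSym_zero : toTilde K (augSym K 0) = 1 := rfl

theorem apply_toTilde_augSym (ζ : TildeSym K →ₐ[K] K) (p : Multiset ℕ+) :
    ζ (toTilde K (augSym K p)) = (p.map fun n => ζ (toTilde K (augSym K {n}))).prod := by
  induction p using Multiset.induction with
  | empty => rw [toTilde_augSym_zero, map_one, Multiset.map_zero, Multiset.prod_zero]
  | cons a p ih =>
    rw [Multiset.map_cons, Multiset.prod_cons, ← ih, ← map_mul, toTilde_augSym_mul,
      Multiset.singleton_add]

/-- The linear form with `m̃_λ ↦ a_(λ₁) ⋯ a_(λ_ℓ)`. -/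
noncomputable def characterLin (a : ℕ+ → K) : TildeSym K →ₗ[K] K :=
  (tildeBasis K).constr K fun p => (p.map a).prod

theorem characterLin_apply (a : ℕ+ → K) (p : Multiset ℕ+) :
    characterLin K a (toTilde K (augSym K p)) = (p.map a).prod := by
  rw [characterLin, ← tildeBasis_apply, Module.Basis.constr_basis]

/-- The character `ζ_a` of `Λ̃`. -/
noncomputable def character (a : ℕ+ → K) : TildeSym K →ₐ[K] K :=
  AlgHom.ofLinearMap (characterLin K a)
    (by rw [← toTilde_augSym_zero, characterLin_apply, Multiset.map_zero, Multiset.prod_zero])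
    (by
      intro f g
      suffices h : (LinearMap.mul K (TildeSym K)).compr₂ (characterLin K a) =
          (LinearMap.mul K K).compl₁₂ (characterLin K a) (characterLin K a) from
        LinearMap.congr_fun₂ h f g
      refine (tildeBasis K).ext fun p => (tildeBasis K).ext fun q => ?_
      rw [LinearMap.compr₂_apply, LinearMap.compl₁₂_apply, LinearMap.mul_apply',
        LinearMap.mul_apply', tildeBasis_apply, tildeBasis_apply, toTilde_augSym_mul,
        characterLin_apply, characterLin_apply, characterLin_apply, Multiset.map_add,
        Multiset.prod_add])

theorem character_apply (a : ℕ+ → K) (p : Multiset ℕ+) :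
    character K a (toTilde K (augSym K p)) = (p.map a).prod :=
  characterLin_apply K a p

/-- Injective because the `m̃_n` generate `Λ̃`; surjective because `character` realizes any
prescribed values. -/
theorem bijective_character_values : Function.Bijective
    (fun (ζ : TildeSym K →ₐ[K] K) (n : ℕ+) => ζ (toTilde K (augSym K {n}))) := by
  constructor
  · intro ζ ξ h
    refine AlgHom.toLinearMap_injective ((tildeBasis K).ext fun p => ?_)
    rw [tildeBasis_apply, AlgHom.toLinearMap_apply, AlgHom.toLinearMap_apply,
      apply_toTilde_augSym, apply_toTilde_augSym K ξ]
    exact congrArg (fun a => (p.map a).prod) h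
  · intro a
    refine ⟨character K a, funext fun n => ?_⟩
    beta_reduce
    rw [character_apply, Multiset.map_singleton, Multiset.prod_singleton]

theorem comul_toTilde_augSym (p : Multiset ℕ+) :
    CoalgebraStruct.comul (R := K) (toTilde K (augSym K p)) =
      (p.antidiagonal.map fun q =>
        toTilde K (augSym K q.1) ⊗ₜ[K] toTilde K (augSym K q.2)).sum := by
  change TensorProduct.map (toTilde K).toLinearMap (toTilde K).toLinearMap
    (comulLin K (augSym K p)) = _
  rw [comulLin_augSym, map_multiset_sum, Multiset.map_map]
  rfl

-- On `m̃_λ` both sides are sums over the antidiagonal with multiplicity: one from the coproduct,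
-- the other from expanding a product of sums by `Multiset.prod_map_add`. Multiplicativity of the
-- convolution then comes for free from `character`.
open WithConv in
theorem convMul_toLinearMap (ζ ξ : TildeSym K →ₐ[K] K) :
    toConv ζ.toLinearMap * toConv ξ.toLinearMap = toConv (character K fun n =>
      ζ (toTilde K (augSym K {n})) + ξ (toTilde K (augSym K {n}))).toLinearMap := by
  rw [LinearMap.convMul_def]
  refine congrArg toConv ((tildeBasis K).ext fun p => ?_)
  rw [tildeBasis_apply, AlgHom.toLinearMap_apply, character_apply, Multiset.prod_map_add,
    LinearMap.comp_apply, LinearMap.comp_apply, comul_toTilde_augSym, map_multiset_sum,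
    map_multiset_sum, Multiset.map_map, Multiset.map_map]
  refine congrArg Multiset.sum (Multiset.map_congr rfl fun q _ => ?_)
  rw [← apply_toTilde_augSym, ← apply_toTilde_augSym]
  rfl

end Characters

/-! ### Monomials of injective color assignments -/

section Placements

variable {T : Type*} [Fintype T] (w : T → ℕ+)

/-- The exponent of `∏ t, x_(g t) ^ w(t)`. -/
noncomputable def placement (g : T → ℕ+) : ℕ+ →₀ ℕ := ∑ t, Finsupp.single (g t) (w t : ℕ)

theorem placement_apply (g : T ↪ ℕ+) (t : T) : placement w g (g t) = w t := by
  classical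
  rw [placement, Finsupp.finsetSum_apply, Finset.sum_eq_single t]
  · simp
  · intro s _ hs
    rw [Finsupp.single_apply, if_neg (fun h => hs (g.injective h))]
  · simp

theorem placement_ne_zero_iff (g : T ↪ ℕ+) (i : ℕ+) :
    placement w g i ≠ 0 ↔ i ∈ Set.range g := by
  constructor
  · contrapose!
    intro h
    rw [placement, Finsupp.finsetSum_apply]
    refine Finset.sum_eq_zero fun t _ => ?_
    rw [Finsupp.single_apply, if_neg fun h' => h ⟨t, h'⟩]
  · rintro ⟨t, rfl⟩
    rw [placement_apply]
    exact (w t).ne_zero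

theorem shape_placement (g : T ↪ ℕ+) : shape (placement w g) = Finset.univ.val.map w := by
  have h : (placement w g).support = Finset.univ.map g := by
    ext i
    rw [Finsupp.mem_support_iff, placement_ne_zero_iff]
    simp
  rw [shape, h, Finset.map_val, Multiset.map_map]
  refine Multiset.map_congr rfl fun t _ => ?_
  rw [Function.comp_apply, placement_apply, PNat.coe_toPNat']

theorem embDomain_placement (σ : Equiv.Perm ℕ+) (g : T ↪ ℕ+) :
    (placement w g).embDomain σ.toEmbedding = placement w (g.trans σ.toEmbedding) := by
  rw [placement, placement, Finsupp.embDomain_eq_mapDomain, Finsupp.mapDomain_finsetSum]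
  simp only [Finsupp.mapDomain_single]
  rfl

theorem placement_comp_perm (g : T ↪ ℕ+) (σ : Equiv.Perm T) (h : w ∘ σ = w) :
    placement w (g ∘ σ) = placement w g := by
  rw [placement, placement, ← Equiv.sum_comp σ fun t => Finsupp.single (g t) (w t : ℕ)]
  refine Finset.sum_congr rfl fun t _ => ?_
  rw [← Function.comp_apply (f := w) (g := σ), h, Function.comp_apply]

/-- Every injection yields this shape, and a permutation of the colors carries its exponent to `d`.
-/
theorem exists_placement {d : ℕ+ →₀ ℕ} (h : shape d = Finset.univ.val.map w) :
    ∃ g : T ↪ ℕ+, placement w g = d := by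
  classical
  let g : T ↪ ℕ+ := (Fintype.equivFin T).toEmbedding.trans
    (Fin.valEmbedding.trans ⟨Nat.succPNat, Nat.succPNat_injective⟩)
  obtain ⟨σ, hσ⟩ := exists_perm_of_shape_eq (h.trans (shape_placement w g).symm)
  exact ⟨g.trans σ.toEmbedding, by rw [← hσ, embDomain_placement]⟩

/-- The support of the exponent is the range of the injection, so `g` and `h` have the same range
and `σ` is `g⁻¹ ∘ h`. It preserves weights because the exponent of a color is the weight placed
there. -/
theorem exists_perm_of_placement_eq {g h : T ↪ ℕ+} (e : placement w h = placement w g) :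
    ∃ σ : Equiv.Perm T, w ∘ σ = w ∧ g ∘ σ = h := by
  have hr (t : T) : ∃ s, g s = h t := by
    rw [← Set.mem_range, ← placement_ne_zero_iff w, ← e, placement_ne_zero_iff]
    exact ⟨t, rfl⟩
  choose σ hσ using hr
  have hi : Function.Injective σ := fun s t hst => h.injective (by rw [← hσ, ← hσ, hst])
  refine ⟨Equiv.ofBijective σ (Finite.injective_iff_bijective.1 hi), funext fun t => ?_,
    funext hσ⟩
  rw [← PNat.coe_inj, Function.comp_apply, Equiv.ofBijective_apply, ← placement_apply w g, hσ,
    ← e, placement_apply]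

/-- Such a permutation acts independently on each fiber of `w`, and the fiber over `i` has `r_i`
elements. -/
theorem card_perm_comp_eq : Nat.card {σ : Equiv.Perm T // w ∘ σ = w} =
    autCard (Finset.univ.val.map w) := by
  classical
  rw [Nat.card_eq_fintype_card, DomMulAct.stabilizer_card', autCard]
  refine Finset.prod_congr (by ext; simp) fun i _ => ?_
  rw [Multiset.count_map, ← Finset.filter_val, Finset.card_val, Fintype.card_subtype]
  simp only [eq_comm]

/-- The placements with the same exponent as `g` are the `g ∘ σ` for weight preserving `σ`. -/
noncomputable def permEquivPlacement (g : T ↪ ℕ+) : {σ : Equiv.Perm T // w ∘ σ = w} ≃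
    {f : T ↪ ℕ+ // placement w f = placement w g} :=
  Equiv.ofBijective
    (fun σ => ⟨σ.1.toEmbedding.trans g, placement_comp_perm w g σ.1 σ.2⟩) <| by
    constructor
    · intro σ τ hστ
      refine Subtype.ext (Equiv.ext fun t => g.injective ?_)
      exact DFunLike.congr_fun (congrArg Subtype.val hστ) t
    · rintro ⟨f, hf⟩
      obtain ⟨σ, h1, h2⟩ := exists_perm_of_placement_eq w hf
      exact ⟨⟨σ, h1⟩, Subtype.ext (DFunLike.coe_injective h2)⟩

instance finite_placement_eq (d : ℕ+ →₀ ℕ) : Finite {g : T ↪ ℕ+ // placement w g = d} := by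
  rcases isEmpty_or_nonempty {g : T ↪ ℕ+ // placement w g = d} with h | ⟨⟨g, rfl⟩⟩
  · infer_instance
  · exact Finite.of_equiv _ (permEquivPlacement w g)

/-- The right side is the coefficient of `x ^ d` in `m̃` of the weights: `m̃` is a sum over
injections. -/
theorem card_placement_eq (d : ℕ+ →₀ ℕ) : Nat.card {g : T ↪ ℕ+ // placement w g = d} =
    if shape d = Finset.univ.val.map w then autCard (Finset.univ.val.map w) else 0 := by
  split_ifs with h
  · obtain ⟨g, rfl⟩ := exists_placement w h
    rw [← card_perm_comp_eq, Nat.card_congr (permEquivPlacement w g)]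
  · rw [Nat.card_eq_zero]
    refine Or.inl ⟨fun g => h ?_⟩
    rw [← g.2, shape_placement]

end Placements

/-! ### Proper colorings, stable partitions and `X_G` -/

theorem finsum_ite_one {ι R : Type*} [Semiring R] (p : ι → Prop) [DecidablePred p]
    (h : {i | p i}.Finite) : (∑ᶠ i, if p i then (1 : R) else 0) = Nat.card {i // p i} := by
  rw [finsum_eq_sum_of_support_subset (s := h.toFinset), Finset.sum_congr rfl
    (g := fun _ => (1 : R)), Finset.sum_const, nsmul_one, ← Set.ncard_eq_toFinset_card _ h]
  · rfl
  · intro i hi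
    exact if_pos (by simpa using hi)
  · intro i hi
    have : p i := by
      by_contra h'
      exact hi (if_neg h')
    simpa using this

theorem _root_.Finpartition.eq_of_part_eq {V : Type*} [DecidableEq V] {s : Finset V} {P Q : Finpartition s}
    (h : ∀ v, P.part v = Q.part v) : P = Q := by
  have key {P Q : Finpartition s} (h : ∀ v, P.part v = Q.part v) : P.parts ⊆ Q.parts := by
    intro t ht
    obtain ⟨v, hv⟩ := P.nonempty_of_mem_parts ht
    rw [← P.part_eq_of_mem ht hv, h]
    exact Q.part_mem.2 (P.le ht hv)
  exact Finpartition.ext (Finset.Subset.antisymm (key h) (key fun v => (h v).symm))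

namespace WeightedGraph

variable {V : Type*} (G : WeightedGraph V)

/-- The weight of a set of vertices. -/
def setWeight (s : Finset V) : ℕ+ := (∑ v ∈ s, (G.weight v : ℕ)).toPNat'

/-- Since `toPNat'` sends `0` to `1`, the empty set is a false case; parts of a `Finpartition` avoid
it. -/
theorem coe_setWeight {s : Finset V} (h : s.Nonempty) :
    (G.setWeight s : ℕ) = ∑ v ∈ s, (G.weight v : ℕ) := by
  refine coe_toPNat' fun h0 => ?_
  obtain ⟨v, hv⟩ := h
  exact (G.weight v).ne_zero (Finset.sum_eq_zero_iff.1 h0 v hv)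

variable [Fintype V] [DecidableEq V]

/-- The partition formed by the weights of the parts. -/
def partType (P : Finpartition (Finset.univ : Finset V)) : Multiset ℕ+ :=
  P.parts.val.map G.setWeight

/-- The parts are stable sets. -/
def IsStable (P : Finpartition (Finset.univ : Finset V)) : Prop :=
  ∀ s ∈ P.parts, G.graph.IsIndepSet (s : Set V)

/-- With positive integer weights, `λ` becomes a function of the stable partition, so sums over `λ`
can be regrouped. -/
theorem mem_stablePartitions (P : Finpartition (Finset.univ : Finset V)) (p : Multiset ℕ+) :
    P ∈ G.stablePartitions p ↔ G.IsStable P ∧ G.partType P = p := by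
  have h : P.parts.val.map (fun s => ∑ v ∈ s, (G.weight v : ℕ)) =
      (G.partType P).map (fun n : ℕ+ => (n : ℕ)) := by
    rw [partType, Multiset.map_map]
    exact Multiset.map_congr rfl fun s hs => (G.coe_setWeight (P.nonempty_of_mem_parts hs)).symm
  refine and_congr Iff.rfl ?_
  rw [h]
  exact (Multiset.map_injective PNat.coe_injective).eq_iff

theorem map_setWeight_parts (P : Finpartition (Finset.univ : Finset V)) :
    (Finset.univ : Finset P.parts).val.map (fun s : P.parts => G.setWeight s) = G.partType P := by
  rw [Finset.univ_eq_attach, Finset.attach_val]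
  exact Multiset.attach_map_val' _ _

/-- The coloring that uses the color `g s` on the part `s`. -/
def coloringOfParts (P : {P : Finpartition (Finset.univ : Finset V) // G.IsStable P})
    (g : ↥P.1.parts ↪ ℕ+) : G.graph.Coloring ℕ+ :=
  SimpleGraph.Coloring.mk (fun v => g ⟨P.1.part v, P.1.part_mem.2 (Finset.mem_univ v)⟩)
    fun {u v} h h' => by
      have e : P.1.part u = P.1.part v := congrArg Subtype.val (g.injective h')
      have hu : u ∈ P.1.part v := e ▸ P.1.mem_part (Finset.mem_univ u)
      exact P.2 _ (P.1.part_mem.2 (Finset.mem_univ v)) hu (P.1.mem_part (Finset.mem_univ v))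
        h.ne h

theorem coloringOfParts_apply (P : {P : Finpartition (Finset.univ : Finset V) // G.IsStable P})
    (g : ↥P.1.parts ↪ ℕ+) (v : V) : G.coloringOfParts P g v =
      g ⟨P.1.part v, P.1.part_mem.2 (Finset.mem_univ v)⟩ := rfl

theorem mem_part_iff_coloringOfParts
    (P : {P : Finpartition (Finset.univ : Finset V) // G.IsStable P})
    (g : ↥P.1.parts ↪ ℕ+) (u v : V) :
    u ∈ P.1.part v ↔ G.coloringOfParts P g u = G.coloringOfParts P g v := by
  rw [P.1.mem_part_iff_part_eq_part (Finset.mem_univ u) (Finset.mem_univ v),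
    coloringOfParts_apply, coloringOfParts_apply, g.injective.eq_iff, Subtype.mk.injEq]

/-- The color classes of the coloring recover the partition, and the colors of the classes recover
the injection. -/
theorem bijective_coloringOfParts : Function.Bijective
    fun x : Σ P : {P : Finpartition (Finset.univ : Finset V) // G.IsStable P},
      (P.1.parts ↪ ℕ+) => G.coloringOfParts x.1 x.2 := by
  constructor
  · rintro ⟨P, g⟩ ⟨Q, h⟩ e
    obtain rfl : P = Q := by
      refine Subtype.ext (Finpartition.eq_of_part_eq fun v => Finset.ext fun u => ?_)
      rw [mem_part_iff_coloringOfParts G P g, mem_part_iff_coloringOfParts G Q h]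
      rw [show G.coloringOfParts P g = G.coloringOfParts Q h from e]
    congr 1
    ext ⟨s, hs⟩ : 1
    obtain ⟨v, hv⟩ := P.1.nonempty_of_mem_parts hs
    have hg := DFunLike.congr_fun e v
    beta_reduce at hg
    simp only [coloringOfParts_apply, P.1.part_eq_of_mem hs hv] at hg
    exact hg
  · intro c
    classical
    let P : Finpartition (Finset.univ : Finset V) := .ofSetoid (Setoid.ker c)
    have hP (u v : V) : u ∈ P.part v ↔ c v = c u := Finpartition.mem_part_ofSetoid_iff_rel
    have hS : G.IsStable P := by
      intro s hs u hu v hv _ huv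
      obtain rfl := P.part_eq_of_mem hs hv
      exact c.valid huv ((hP u v).1 hu).symm
    -- The color of a part is read off at a representative `r s`; `c` is constant on parts.
    choose r hr using fun s : P.parts => P.nonempty_of_mem_parts s.2
    refine ⟨⟨⟨P, hS⟩, ⟨fun s => c (r s), fun s t hst => Subtype.ext ?_⟩⟩,
      DFunLike.ext _ _ fun v => ?_⟩
    · have h := (hP (r t) (r s)).2 hst
      rw [P.part_eq_of_mem s.2 (hr s)] at h
      exact P.eq_of_mem_parts s.2 t.2 h (hr t)
    · exact ((hP _ _).1 (hr ⟨P.part v, _⟩)).symm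

/-- All vertices of a part share its color, so their exponents add up to the weight of the part. -/
theorem placement_coloringOfParts
    (P : {P : Finpartition (Finset.univ : Finset V) // G.IsStable P})
    (g : ↥P.1.parts ↪ ℕ+) : placement G.weight (G.coloringOfParts P g) =
      placement (fun s : P.1.parts => G.setWeight s) g := by
  rw [placement, placement, ← Finset.sum_fiberwise Finset.univ
    fun v => (⟨P.1.part v, P.1.part_mem.2 (Finset.mem_univ v)⟩ : P.1.parts)]
  refine Finset.sum_congr rfl fun s _ => ?_
  have hs : Finset.univ.filter (fun v =>
      (⟨P.1.part v, P.1.part_mem.2 (Finset.mem_univ v)⟩ : P.1.parts) = s) = s.1 := by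
    ext v
    rw [Finset.mem_filter, Subtype.ext_iff, ← P.1.part_eq_iff_mem s.2]
    simp
  rw [G.coe_setWeight (P.1.nonempty_of_mem_parts s.2), ← Finsupp.singleAddHom_apply, map_sum]
  refine Finset.sum_congr hs fun v hv => ?_
  simp only [coloringOfParts_apply, P.1.part_eq_of_mem s.2 hv]
  rfl

/-- A proper coloring is a partition into stable sets with distinct colors on its parts. -/
noncomputable def coloringEquiv : (Σ P : {P : Finpartition (Finset.univ : Finset V) // G.IsStable P},
    (P.1.parts ↪ ℕ+)) ≃ G.graph.Coloring ℕ+ :=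
  Equiv.ofBijective _ G.bijective_coloringOfParts

theorem placement_coloringEquiv (x : Σ P : {P : Finpartition (Finset.univ : Finset V) //
    G.IsStable P}, (P.1.parts ↪ ℕ+)) : placement G.weight (G.coloringEquiv x) =
      placement (fun s : x.1.1.parts => G.setWeight s) x.2 :=
  G.placement_coloringOfParts x.1 x.2

/-- The proper colorings with a given exponent, by their color classes. -/
noncomputable def coloringPlacementEquiv (d : ℕ+ →₀ ℕ) :
    (Σ P : {P : Finpartition (Finset.univ : Finset V) // G.IsStable P},
      {g : ↥P.1.parts ↪ ℕ+ // placement (fun s : P.1.parts => G.setWeight s) g = d}) ≃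
      {c : G.graph.Coloring ℕ+ // placement G.weight c = d} where
  toFun x := ⟨G.coloringEquiv ⟨x.1, x.2.1⟩, by rw [placement_coloringEquiv]; exact x.2.2⟩
  invFun c := ⟨(G.coloringEquiv.symm c.1).1, (G.coloringEquiv.symm c.1).2, by
    rw [← placement_coloringEquiv, Equiv.apply_symm_apply, c.2]⟩
  left_inv x := by
    rcases x with ⟨P, g, hg⟩
    dsimp only
    have h := G.coloringEquiv.symm_apply_apply ⟨P, g⟩
    -- The proof component mentions the recovered pair, which is therefore made a variable `y`
    -- before `h` is substituted.
    generalize_proofs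
    generalize G.coloringEquiv.symm (G.coloringEquiv ⟨P, g⟩) = y at *
    subst h
    rfl
  right_inv c := Subtype.ext (G.coloringEquiv.apply_symm_apply c.1)

open Classical in
theorem card_coloring_placement_eq (d : ℕ+ →₀ ℕ) :
    Nat.card {c : G.graph.Coloring ℕ+ // placement G.weight c = d} =
      ∑ P with G.IsStable P, if shape d = G.partType P then autCard (G.partType P) else 0 := by
  rw [← Nat.card_congr (G.coloringPlacementEquiv d), Nat.card_sigma]
  simp only [card_placement_eq, map_setWeight_parts]
  exact (Finset.sum_subtype (Finset.univ.filter G.IsStable) (fun P => by simp) fun P =>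
    if shape d = G.partType P then autCard (G.partType P) else 0).symm

variable (K : Type*) [Field K]

open Classical in
/-- `X_G` is the sum of the `m̃` of the types of the partitions into stable sets. -/
theorem csf_eq_sum : G.csf K = ∑ P with G.IsStable P, augSym K (G.partType P) := by
  ext d
  have hc (c : G.graph.Coloring ℕ+) :
      coeff d (∏ v, (X (c v) : MvPowerSeries ℕ+ K) ^ (G.weight v : ℕ)) =
        if placement G.weight c = d then 1 else 0 := by
    rw [prod_X_pow, coeff_monomial]
    exact if_congr eq_comm rfl rfl
  have hf : {c : G.graph.Coloring ℕ+ | placement G.weight c = d}.Finite := by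
    refine (finite_colorings K G d).subset fun c hcd => ?_
    rw [Function.mem_support, hc, if_pos (show placement G.weight c = d from hcd)]
    exact one_ne_zero
  -- Each coloring contributes a single monomial, so the coefficient counts the colorings with
  -- exponent `d`.
  have hl : coeff d (G.csf K : MvPowerSeries ℕ+ K) =
      Nat.card {c : G.graph.Coloring ℕ+ // placement G.weight c = d} := by
    rw [← finsum_ite_one _ hf]
    exact finsum_congr hc
  have hr : coeff d ((∑ P with G.IsStable P, augSym K (G.partType P) : SymFun K) :
      MvPowerSeries ℕ+ K) = ∑ P with G.IsStable P,
        coeff d (augSym K (G.partType P) : MvPowerSeries ℕ+ K) := by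
    rw [← map_sum, ← Subalgebra.coe_val, ← map_sum]
  rw [hl, hr, card_coloring_placement_eq, Nat.cast_sum]
  refine Finset.sum_congr rfl fun P _ => ?_
  change _ = (autCard (G.partType P) : K) * coeff d (monoSym K (G.partType P) : MvPowerSeries ℕ+ K)
  rw [coeff_monoSym, mul_ite, mul_one, mul_zero, Nat.cast_ite, Nat.cast_zero]

-- The stable partitions are grouped by type; a `λ` that is not a type contributes zero, so the sum
-- is finite.
open Classical in
theorem finsum_ncard_stablePartitions (f : Multiset ℕ+ → K) :
    ∑ᶠ p, ((G.stablePartitions p).ncard : K) * f p =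
      ∑ P with G.IsStable P, f (G.partType P) := by
  have hn (p : Multiset ℕ+) : (G.stablePartitions p).ncard =
      ((Finset.univ.filter G.IsStable).filter fun P => G.partType P = p).card := by
    rw [← Set.ncard_coe_finset]
    congr 1
    ext P
    simp [mem_stablePartitions]
  rw [Finset.sum_comp f G.partType, finsum_eq_sum_of_support_subset]
  · refine Finset.sum_congr rfl fun p _ => ?_
    rw [hn, nsmul_eq_mul]
  · intro p hp
    by_contra h
    refine hp ?_
    have h0 : (G.stablePartitions p).ncard = 0 := by
      rw [hn, Finset.card_eq_zero, Finset.filter_eq_empty_iff]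
      intro P hP hPp
      exact h (Finset.mem_coe.2 (Finset.mem_image.2 ⟨P, hP, hPp⟩))
    beta_reduce
    rw [h0, Nat.cast_zero, zero_mul]

theorem finite_stablePartitions_nonempty :
    {p : Multiset ℕ+ | (G.stablePartitions p).Nonempty}.Finite := by
  refine (Set.finite_range G.partType).subset ?_
  rintro p ⟨P, hP⟩
  exact ⟨P, ((G.mem_stablePartitions P p).1 hP).2⟩

end WeightedGraph
end ChromaticTilde

open ChromaticTilde WithConv in
theorem proposition1p3 (K : Type*) [Field K] [CharZero K] :
    Function.Bijective
      (fun (ζ : TildeSym K →ₐ[K] K) (n : ℕ+) => ζ (toTilde K (augSym K {n}))) ∧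
    (∀ (ζ : TildeSym K →ₐ[K] K) (V : Type*) [Fintype V] [DecidableEq V] (G : WeightedGraph V),
      {p : Multiset ℕ+ | (G.stablePartitions p).Nonempty}.Finite ∧
      ζ (toTilde K (G.csf K)) = ∑ᶠ p : Multiset ℕ+, ((G.stablePartitions p).ncard : K) *
        (p.map fun n => ζ (toTilde K (augSym K {n}))).prod) ∧
    ∀ ζ ξ : TildeSym K →ₐ[K] K, ∃ η : TildeSym K →ₐ[K] K,
      toConv η.toLinearMap = toConv ζ.toLinearMap * toConv ξ.toLinearMap ∧
      ∀ n : ℕ+, η (toTilde K (augSym K {n})) =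
        ζ (toTilde K (augSym K {n})) + ξ (toTilde K (augSym K {n})) := by
  -- The last two claims concern arbitrary characters, which by the first are exactly the `ζ_a`.
  refine ⟨bijective_character_values K, fun ζ V _ _ G =>
    ⟨G.finite_stablePartitions_nonempty, ?_⟩, fun ζ ξ =>
    ⟨_, (convMul_toLinearMap K ζ ξ).symm, fun n => ?_⟩⟩
  · rw [G.finsum_ncard_stablePartitions K, G.csf_eq_sum K, map_sum, map_sum]
    exact Finset.sum_congr rfl fun P _ => apply_toTilde_augSym K ζ _
  · rw [character_apply, Multiset.map_singleton, Multiset.prod_singleton]
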